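/- Let $k:[0,1]\times[0,1]\times\mathbb R\to\mathbb R$ and $f:[0,1]\to\mathbb R$ be continuous, let $X=C[0,1]$ with the supremum norm, and let $K:X\to X$, $K(x)(s)=\int_0^1 k(s,t,x(t))\,dt$, be the Urysohn integral operator. Assume that $x-K(x)=f$ has a unique solution $\varphi\in X$, let $a,b$ be real numbers with $\varphi([0,1])\subset(a,b)$, and put $\Omega=[0,1]\times[0,1]\times[a,b]$. Let $\alpha\ge 1$, $k\in C^\alpha(\Omega)$, $\partial k/\partial u\in C^{2\alpha}(\Omega)$, $f\in C^\alpha[0,1]$ (for non-integer orders these are the usual Hölder classes), and assume that $1$ is not an eigenvalue of the Fréchet derivative $K'(\varphi)$. Let $d\ge1$ be an integer, and for $n\ge1$ let $h=1/n$, let $t_i=ih$ for $0\le i\le n$, extended by $t_i=0$ for $i<0$ and $t_i=1$ for $i>n$, and let $\mathcal S_n$ be the space of splines of degree $d$ and class $C^{d-1}$ on $[0,1]$ with knots $t_0,\dots,t_n$. Let $B_1,\dots,B_{n+d}$ be its B-spline basis, $B_i$ having support $[t_{i-d-1},t_i]$, and let $\xi_j=j/(2n)$, $0\le j\le 2n$.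 Let $\rho\ge 0$ be an integer that does not depend on $n$. For all sufficiently large $n$ let $\pi_n:C[0,1]\to\mathcal S_n$ be a spline quasi-interpolating projector, that is, $\pi_n x=\sum_{i=1}^{n+d}\lambda_i(x)B_i$, where $\lambda_i(x)$ is a fixed linear combination of the values $x(\xi_j)$ at nodes $\xi_j\in[t_{i-d-1-\rho},t_{i+\rho}]$ (for $\rho=0$: nodes in the support of $B_i$), and $\pi_nx=x$ for every $x\in\mathcal S_n$. Assume that the norms $\|\pi_n\|$ are uniformly bounded. Define $$K_n^H(x)=\pi_nK(x)+K(\pi_nx)-\pi_nK(\pi_nx),\qquad x\in X.$$ Then there is $\delta_0>0$ such that for all sufficiently large $n$ the equation $\varphi_n^H-K_n^H(\varphi_n^H)=f$ has a unique solution $\varphi_n^H$ with $\|\varphi_n^H-\varphi\|_\infty<\delta_0$, and $$\|\varphi_n^H-\varphi\|_\infty=O(h^{2\beta})\quad(n\to\infty),\qquad \beta=\min\{\alpha,d+1\}.$$ -/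

import Mathlib

open Set Filter Topology MeasureTheory Asymptotics
open scoped unitInterval

noncomputable section

namespace SplineQIP

/-! ### Smoothness classes -/

/-- `g` is of class `C^α` on `S`, for a real `α ≥ 0`. If `α = m` is an integer and `S` is compact,
this is just `m`-fold continuous differentiability up to the boundary: the second clause then only
says that the continuous `m`-th derivative has bounded oscillation. For non-integer `α` the
derivative of order `⌊α⌋` is moreover Hölder continuous with exponent `α - ⌊α⌋`. -/
def IsCAlphaOn {E : Type*} [NormedAddCommGroup E] [NormedSpace ℝ E]
    (α : ℝ) (g : E → ℝ) (S : Set E) : Prop :=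
  ContDiffOn ℝ (⌊α⌋₊ : ℕ) g S ∧
    ∃ C : ℝ, ∀ x ∈ S, ∀ y ∈ S,
      ‖iteratedFDerivWithin ℝ ⌊α⌋₊ g S x - iteratedFDerivWithin ℝ ⌊α⌋₊ g S y‖
        ≤ C * ‖x - y‖ ^ (α - (⌊α⌋₊ : ℝ))

/-- The function on `ℝ` that agrees with `x` on `[0,1]` (it is constant on either side, and is only
used on `[0,1]`). -/
def onReal (x : C(I, ℝ)) : ℝ → ℝ := IccExtend zero_le_one x

/-- The box `[0,1] × [0,1] × [a,b]`. -/
def box (a b : ℝ) : Set (ℝ × ℝ × ℝ) := Icc 0 1 ×ˢ Icc 0 1 ×ˢ Icc a b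

/-- The partial derivative `∂k/∂u` on the box (one-sided at `u = a` and `u = b`). -/
def partialU (k : ℝ × ℝ × ℝ → ℝ) (a b : ℝ) (p : ℝ × ℝ × ℝ) : ℝ :=
  derivWithin (fun u => k (p.1, p.2.1, u)) (Icc a b) p.2.2

/-! ### The Urysohn operator -/

/-- The set `[0,1] × [0,1] × ℝ` on which a kernel lives. -/
def kernelDomain : Set (ℝ × ℝ × ℝ) := Icc 0 1 ×ˢ Icc 0 1 ×ˢ univ

theorem continuous_urysohn {k : ℝ × ℝ × ℝ → ℝ} (hk : ContinuousOn k kernelDomain)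
    (x : C(I, ℝ)) : Continuous fun s : I => ∫ t : I, k ((s : ℝ), (t : ℝ), x t) := by
  have h : Continuous (Function.uncurry fun s t : I => k ((s : ℝ), (t : ℝ), x t)) := by
    refine hk.comp_continuous (by fun_prop) ?_
    rintro ⟨s, t⟩
    exact ⟨s.2, t.2, mem_univ _⟩
  simpa using continuous_parametric_integral_of_continuous (μ := (volume : Measure I)) h
    isCompact_univ

/-- The Urysohn integral operator `K(x)(s) = ∫₀¹ k(s,t,x(t)) dt` on `C[0,1]`. -/
def urysohn (k : ℝ × ℝ × ℝ → ℝ) (hk : ContinuousOn k kernelDomain) (x : C(I, ℝ)) : C(I, ℝ) where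
  toFun s := ∫ t : I, k ((s : ℝ), (t : ℝ), x t)
  continuous_toFun := continuous_urysohn hk x

/-- The operator `P K(x) + K(P x) - P K(P x)` of the modified projection method. -/
def modifiedOp (K : C(I, ℝ) → C(I, ℝ)) (P : C(I, ℝ) →L[ℝ] C(I, ℝ)) (x : C(I, ℝ)) : C(I, ℝ) :=
  P (K x) + K (P x) - P (K (P x))

/-! ### Splines, B-splines and quasi-interpolating projectors -/

/-- The uniform knots `t_i = i / n`, `0 ≤ i ≤ n`, extended by `t_i = 0` for `i < 0` and `t_i = 1`
for `i > n`. -/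
def knot (n : ℕ) (i : ℤ) : ℝ := ((max 0 (min i n) : ℤ) : ℝ) / n

/-- The B-spline of degree `d` on the knots `t_i, …, t_{i+d+1}`, by the Cox-de Boor recursion (a
quotient with denominator `0` counts as `0`). In degree `0` it is the indicator function of
`[t_i, t_{i+1})`, where the last nonempty interval is closed, so that the B-splines of positive
degree are continuous on `[0,1]` including the right end point. -/
def bspline (n : ℕ) : ℕ → ℤ → ℝ → ℝ
  | 0, i, t =>
      open Classical in
      if (knot n i ≤ t ∧ t < knot n (i + 1)) ∨ (t = 1 ∧ knot n i < 1 ∧ knot n (i + 1) = 1)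
      then 1 else 0
  | d + 1, i, t =>
      (t - knot n i) / (knot n (i + d + 1) - knot n i) * bspline n d i t +
        (knot n (i + d + 2) - t) / (knot n (i + d + 2) - knot n (i + 1)) * bspline n d (i + 1) t

/-- The space of splines of degree `d` and class `C^(d-1)` on `[0,1]` with knots `i / n`
(for `d ≥ 1`). -/
def splineSpace (d n : ℕ) : Set C(I, ℝ) :=
  {x | ContDiffOn ℝ (d - 1 : ℕ) (onReal x) (Icc 0 1) ∧
    ∀ i : Fin n, ∃ p : Polynomial ℝ, p.natDegree ≤ d ∧
      ∀ t : I, (t : ℝ) ∈ Icc (knot n i) (knot n (i + 1)) → x t = p.eval (t : ℝ)}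

/-- The quasi-interpolation nodes `ξ_j = j / (2n)`, `0 ≤ j ≤ 2n`: the knots and the midpoints
between neighbouring knots. -/
def node (n : ℕ) (j : Fin (2 * n + 1)) : I :=
  ⟨(j : ℝ) / (2 * n), by positivity, by
    refine div_le_one_of_le₀ ?_ (by positivity)
    have := j.2
    exact_mod_cast (by omega : (j : ℕ) ≤ 2 * n)⟩

/-- `P` is a spline quasi-interpolating projector of degree `d` on the knots `i / n`:
`P x = ∑_i λ_i(x) B_i`, where `B_i`, `i = 0, …, n+d-1`, are the B-splines of degree `d`, with
support `[t_{i-d}, t_{i+1}]`, and `λ_i(x) = ∑_j w_{i,j} x(ξ_j)` is a local functional, and `P`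
reproduces every spline. A functional `λ_i` may use the nodes in the support of `B_i` widened by
`ρ` mesh intervals on either side; `ρ = 0` means: exactly the nodes in the support of `B_i`. -/
def IsQIP (d ρ n : ℕ) (P : C(I, ℝ) →L[ℝ] C(I, ℝ)) : Prop :=
  ∃ w : Fin (n + d) → Fin (2 * n + 1) → ℝ,
    (∀ i j, w i j ≠ 0 →
      (node n j : ℝ) ∈ Icc (knot n ((i : ℤ) - d - ρ)) (knot n ((i : ℤ) + 1 + ρ))) ∧
    (∀ (x : C(I, ℝ)) (t : I),
      P x t = ∑ i, (∑ j, w i j * x (node n j)) * bspline n d ((i : ℤ) - d) t) ∧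
    ∀ x ∈ splineSpace d n, P x = x

end SplineQIP

end

open Set Filter Topology MeasureTheory Asymptotics
open scoped unitInterval

noncomputable section

namespace SplineQIP

/-! Write `P = π n` and `G y = y - modifiedOp K P y - f`. Since `φ - K φ = f`, the residual is `G φ
= (1 - P)(K φ - K (P φ))`, and the doubled order comes from two independent factors `h^β`.

The first is `‖φ - P φ‖ = O(h^β)`: `f` is smooth, and `K φ` inherits the smoothness of `k` in `s`.
The second is that `(1 - P) ∘ K` has Lipschitz constant `O(h^β)` near `φ`, by the smoothness of
`∂k/∂u` in `s` (`IsLocalReproducing.norm_urysohn_sub_urysohn_sub_le`). Both rest on local Taylor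
approximation, which a bounded, local, polynomial-reproducing `P` turns into a projection error.

The same Lipschitz bound makes `G` a small perturbation of `1 - K`, hence of the linear map `1 -
K'(φ)`. It also exhibits `K'(φ)` as a norm limit of finite rank operators, so by the Fredholm
alternative `1 - K'(φ)` is invertible. A contraction argument (`existsUnique_zero_of_approx`) then
gives the unique zero and bounds its error by the residual. -/

/-! ### Local polynomial approximation of functions of class `C^α` -/

/-- Near every point of `[0,1]` the function `g` is approximated to order `β`, with constant `C`,
by a polynomial of degree at most `d`. -/
def HasTaylorBound (d : ℕ) (β C : ℝ) (g : ℝ → ℝ) : Prop :=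
  ∀ s ∈ Icc (0 : ℝ) 1, ∃ p : Polynomial ℝ, p.natDegree ≤ d ∧
    ∀ τ ∈ Icc (0 : ℝ) 1, |g τ - p.eval τ| ≤ C * |τ - s| ^ β

theorem HasTaylorBound.mono {d : ℕ} {β β' C C' : ℝ} {g : ℝ → ℝ} (h : HasTaylorBound d β C g)
    (hβ' : 0 < β') (hβ : β' ≤ β) (hC0 : 0 ≤ C') (hC : C ≤ C') : HasTaylorBound d β' C' g := by
  intro s hs
  obtain ⟨p, hp, h⟩ := h s hs
  refine ⟨p, hp, fun τ hτ => (h τ hτ).trans ?_⟩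
  have h1 : |τ - s| ≤ 1 := abs_le.2 ⟨by linarith [hτ.1, hs.2], by linarith [hτ.2, hs.1]⟩
  exact mul_le_mul hC (Real.rpow_le_rpow_of_exponent_ge_of_imp (abs_nonneg _) h1 hβ
    fun _ h0 => absurd h0 (hβ'.trans_le hβ).ne') (by positivity) hC0

/-- Induction on `m`: the remainder vanishes at `s`, and its derivative is the remainder of the
shifted chain `g (j + 1)`. The mean value inequality between `s` and `τ` gains one factor `|τ - s|`.
-/
theorem taylor_sum_bound {γ C s : ℝ} (hγ : 0 ≤ γ) (hC : 0 ≤ C) (hs : s ∈ Icc (0 : ℝ) 1) (m : ℕ)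
    (g : ℕ → ℝ → ℝ)
    (hg : ∀ j < m, ∀ x ∈ Icc (0 : ℝ) 1, HasDerivWithinAt (g j) (g (j + 1) x) (Icc 0 1) x)
    (hm : ∀ x ∈ Icc (0 : ℝ) 1, |g m x - g m s| ≤ C * |x - s| ^ γ) :
    ∀ τ ∈ Icc (0 : ℝ) 1,
      |g 0 τ - ∑ j ∈ Finset.range (m + 1), g j s / (j.factorial : ℝ) * (τ - s) ^ j|
        ≤ C * |τ - s| ^ (γ + m) := by
  induction m generalizing g with
  | zero => simpa using hm
  | succ m ih =>
    intro τ hτ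
    have ih' := ih (fun j => g (j + 1)) (fun j hj => hg (j + 1) (by omega)) hm
    have hsub : uIcc s τ ⊆ Icc 0 1 := uIcc_subset_Icc hs hτ
    set F : ℝ → ℝ := fun τ =>
      g 0 τ - ∑ j ∈ Finset.range (m + 1 + 1), g j s / (j.factorial : ℝ) * (τ - s) ^ j with hF
    have hder : ∀ x ∈ uIcc s τ, HasDerivWithinAt F
        (g 1 x - ∑ j ∈ Finset.range (m + 1), g (j + 1) s / (j.factorial : ℝ) * (x - s) ^ j)
        (uIcc s τ) x := by
      intro x hx
      refine ((hg 0 (by omega) x (hsub hx)).mono hsub).sub (HasDerivAt.hasDerivWithinAt ?_)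
      simp only [Finset.sum_range_succ' _ (m + 1), pow_zero]
      refine (HasDerivAt.fun_sum fun j _ => ?_).add_const _
      have h1 := (((hasDerivAt_id x).sub_const s).pow (j + 1)).const_mul
        (g (j + 1) s / ((j + 1).factorial : ℝ))
      refine h1.congr_deriv ?_
      have h2 : (j.factorial : ℝ) ≠ 0 := by positivity
      have h3 : (j + 1 : ℝ) ≠ 0 := by positivity
      simp only [Nat.factorial_succ, Nat.cast_mul, Nat.cast_add, Nat.cast_one, id,
        Nat.add_sub_cancel]
      field_simp
    have hbd := (convex_uIcc s τ).norm_image_sub_le_of_norm_hasDerivWithin_le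
      (C := C * |τ - s| ^ (γ + m)) hder (fun x hx => (ih' x (hsub hx)).trans ?_)
      left_mem_uIcc right_mem_uIcc
    · have hFs : F s = 0 := by
        simp [hF, Finset.sum_range_succ' _ (m + 1)]
      rw [hFs, sub_zero, Real.norm_eq_abs, Real.norm_eq_abs, mul_assoc,
        ← Real.rpow_add_one' (abs_nonneg _) (by positivity)] at hbd
      refine hbd.trans_eq ?_
      push_cast
      ring_nf
    · gcongr C * ?_ ^ _
      exact abs_sub_left_of_mem_uIcc hx

theorem hasTaylorBound_of_chain {d m : ℕ} (hmd : m ≤ d) {γ C : ℝ} (hγ : 0 ≤ γ) (hC : 0 ≤ C)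
    (g : ℕ → ℝ → ℝ)
    (hg : ∀ j < m, ∀ x ∈ Icc (0 : ℝ) 1, HasDerivWithinAt (g j) (g (j + 1) x) (Icc 0 1) x)
    (hm : ∀ x ∈ Icc (0 : ℝ) 1, ∀ s ∈ Icc (0 : ℝ) 1, |g m x - g m s| ≤ C * |x - s| ^ γ) :
    HasTaylorBound d (γ + m) C (g 0) := by
  intro s hs
  refine ⟨∑ j ∈ Finset.range (m + 1), Polynomial.C (g j s / (j.factorial : ℝ)) *
    (Polynomial.X - Polynomial.C s) ^ j, ?_, fun τ hτ => ?_⟩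
  · refine Polynomial.natDegree_sum_le_of_forall_le _ _ fun j hj => ?_
    refine (Polynomial.natDegree_C_mul_le _ _).trans ?_
    rw [Polynomial.natDegree_pow, Polynomial.natDegree_X_sub_C]
    have := Finset.mem_range.1 hj
    omega
  · simpa [Polynomial.eval_finsetSum] using
      taylor_sum_bound hγ hC hs m g hg (fun x hx => hm x hx s hs) τ hτ

theorem hasDerivWithinAt_iteratedFDerivWithin_line {E : Type*} [NormedAddCommGroup E]
    [NormedSpace ℝ E] {g : E → ℝ} {S : Set E} (hS : UniqueDiffOn ℝ S) {m j : ℕ} (hj : j < m)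
    (hg : ContDiffOn ℝ m g S) {l : ℝ → E} {e : E} (hl : MapsTo l (Icc 0 1) S)
    (hle : ∀ x, HasDerivAt l e x) {x : ℝ} (hx : x ∈ Icc (0 : ℝ) 1) :
    HasDerivWithinAt (fun s => iteratedFDerivWithin ℝ j g S (l s) fun _ => e)
      (iteratedFDerivWithin ℝ (j + 1) g S (l x) fun _ => e) (Icc 0 1) x := by
  have h1 := ((hg.differentiableOn_iteratedFDerivWithin (mod_cast hj) hS) (l x)
    (hl hx)).hasFDerivWithinAt.comp_hasDerivWithinAt x (hle x).hasDerivWithinAt hl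
  exact ((ContinuousMultilinearMap.apply ℝ (fun _ : Fin j => E) ℝ
    fun _ => e).hasFDerivAt.comp_hasDerivWithinAt x h1)

/-- Taylor's formula along a line in direction `e`. The constant does not depend on the line, which
later makes the bound uniform in `(t, u)`. -/
theorem IsCAlphaOn.exists_hasTaylorBound {E : Type*} [NormedAddCommGroup E] [NormedSpace ℝ E]
    {g : E → ℝ} {S : Set E} (hS : UniqueDiffOn ℝ S) (hSc : IsCompact S) {α : ℝ} (hα : 0 ≤ α)
    (hg : IsCAlphaOn α g S) (e : E) (he : ‖e‖ ≤ 1) (d : ℕ) :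
    ∃ C, 0 ≤ C ∧ ∀ l : ℝ → E, MapsTo l (Icc 0 1) S → (∀ x, HasDerivAt l e x) →
      (∀ x y, l x - l y = (x - y) • e) →
      HasTaylorBound d (min α ((d : ℝ) + 1)) C (g ∘ l) := by
  have happ : ∀ (j : ℕ) (A : ContinuousMultilinearMap ℝ (fun _ : Fin j => E) ℝ),
      |A fun _ => e| ≤ ‖A‖ := by
    intro j A
    refine (A.le_opNorm _).trans (mul_le_of_le_one_right (norm_nonneg _) ?_)
    exact Finset.prod_le_one (fun _ _ => norm_nonneg _) fun _ _ => he
  obtain ⟨hgd, C, hC⟩ := hg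
  by_cases hαd : α < d + 1
  · have hm : ⌊α⌋₊ ≤ d := by
      have := (Nat.floor_lt hα).2 (by exact_mod_cast hαd : α < ((d + 1 : ℕ) : ℝ))
      omega
    refine ⟨|C|, abs_nonneg _, fun l hl hle hll => ?_⟩
    have hγ : 0 ≤ α - (⌊α⌋₊ : ℝ) := sub_nonneg.2 (Nat.floor_le hα)
    have := hasTaylorBound_of_chain hm hγ (abs_nonneg C)
      (fun j s => iteratedFDerivWithin ℝ j g S (l s) fun _ => e)
      (fun j hj x hx => hasDerivWithinAt_iteratedFDerivWithin_line hS hj hgd hl hle hx)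
      (fun x hx s hs => ?_)
    · rw [min_eq_left hαd.le]
      simpa [Function.comp_def] using this
    · rw [← _root_.sub_apply]
      refine (happ _ _).trans ((hC _ (hl hx) _ (hl hs)).trans ?_)
      gcongr ?_ * ?_ ^ _
      · exact le_abs_self C
      · rw [hll, norm_smul, Real.norm_eq_abs]
        exact mul_le_of_le_one_right (abs_nonneg _) he
  -- Degree `d` saturates the order here: the derivative of order `d + 1` is bounded by compactness,
  -- so the one of order `d` is Lipschitz, giving order `1 + d`.
  · rw [not_lt] at hαd
    have hm : d + 1 ≤ ⌊α⌋₊ := Nat.le_floor (by exact_mod_cast hαd)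
    have hgd' : ContDiffOn ℝ (d + 1 : ℕ) g S := hgd.of_le (by exact_mod_cast hm)
    obtain ⟨B, hB⟩ := hSc.exists_bound_of_continuousOn
      (hgd'.continuousOn_iteratedFDerivWithin le_rfl hS)
    refine ⟨|B|, abs_nonneg _, fun l hl hle _ => ?_⟩
    have := hasTaylorBound_of_chain (le_refl d) zero_le_one (abs_nonneg B)
      (fun j s => iteratedFDerivWithin ℝ j g S (l s) fun _ => e)
      (fun j hj x hx => hasDerivWithinAt_iteratedFDerivWithin_line hS (Nat.lt_succ_of_lt hj) hgd'
        hl hle hx)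
      (fun x hx s hs => ?_)
    · rw [min_eq_right hαd, add_comm]
      simpa [Function.comp_def] using this
    · rw [Real.rpow_one]
      exact (convex_Icc (0 : ℝ) 1).norm_image_sub_le_of_norm_hasDerivWithin_le
        (fun y hy => hasDerivWithinAt_iteratedFDerivWithin_line hS (Nat.lt_succ_self d) hgd' hl
          hle hy) (fun y hy => (happ _ _).trans ((hB _ (hl hy)).trans (le_abs_self B))) hs hx

/-! ### Locality of the quasi-interpolating projectors -/

theorem knot_mono (n : ℕ) : Monotone (knot n) := by
  intro i j hij
  unfold knot
  gcongr

theorem knot_sub_knot_le (n : ℕ) {i j : ℤ} (hij : i ≤ j) : knot n j - knot n i ≤ (j - i) / n := by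
  unfold knot
  rw [← sub_div]
  refine div_le_div_of_nonneg_right ?_ n.cast_nonneg
  have : max 0 (min j n) - max 0 (min i n) ≤ j - i := by omega
  exact_mod_cast this

theorem mem_Icc_of_bspline_ne_zero {n d : ℕ} {i : ℤ} {t : ℝ} (h : bspline n d i t ≠ 0) :
    t ∈ Icc (knot n i) (knot n (i + d + 1)) := by
  induction d generalizing i with
  | zero =>
    rw [bspline] at h
    have h' := (ne_eq _ _ ▸ h : ¬ _ = _)
    split_ifs at h' with hc
    · rcases hc with hc | hc
      · exact ⟨hc.1, by simpa using hc.2.le⟩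
      · exact ⟨by rw [hc.1]; exact hc.2.1.le, by simp [hc.1, hc.2.2]⟩
    · exact absurd rfl h'
  | succ d ih =>
    rw [bspline] at h
    by_cases h1 : bspline n d i t = 0
    · by_cases h2 : bspline n d (i + 1) t = 0
      · simp [h1, h2] at h
      · have := ih h2
        refine ⟨(knot_mono n (by omega)).trans this.1, this.2.trans (knot_mono n ?_)⟩
        push_cast
        omega
    · have := ih h1
      refine ⟨this.1, this.2.trans (knot_mono n ?_)⟩
      push_cast
      omega

theorem polynomial_mem_splineSpace (d n : ℕ) {p : Polynomial ℝ} (hp : p.natDegree ≤ d) :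
    (⟨fun t : I => p.eval (t : ℝ), by fun_prop⟩ : C(I, ℝ)) ∈ splineSpace d n := by
  refine ⟨?_, fun _ => ⟨p, hp, fun _ _ => rfl⟩⟩
  refine (Polynomial.contDiff_aeval p _).contDiffOn.congr fun t ht => ?_
  simp [onReal, IccExtend_of_mem _ _ ht]

/-- `P` is given by finite sums over the nodes within distance `r`, and reproduces polynomials of
degree at most `d`. -/
structure IsLocalReproducing (d n : ℕ) (r : ℝ) (P : C(I, ℝ) →L[ℝ] C(I, ℝ))
    (c : I → Fin (2 * n + 1) → ℝ) : Prop where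
  apply_eq : ∀ x t, P x t = ∑ j, c t j * x (node n j)
  dist_le : ∀ t j, c t j ≠ 0 → |(node n j : ℝ) - t| ≤ r
  reproduces : ∀ (x : C(I, ℝ)) (p : Polynomial ℝ), p.natDegree ≤ d →
    (∀ t : I, x t = p.eval (t : ℝ)) → P x = x

/-- If `B_i(t) ≠ 0`, then `t` and the nodes used by `λ_i` lie in one interval of at most `d + 1 +
2ρ` meshes. Polynomials are reproduced because they are splines. -/
theorem IsQIP.exists_isLocalReproducing {d ρ n : ℕ} {P : C(I, ℝ) →L[ℝ] C(I, ℝ)}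
    (h : IsQIP d ρ n P) :
    ∃ c, IsLocalReproducing d n ((d + 1 + 2 * ρ : ℕ) * (1 / (n : ℝ))) P c := by
  obtain ⟨w, hw, hP, hS⟩ := h
  refine ⟨fun t j => ∑ i, w i j * bspline n d ((i : ℤ) - d) t, fun x t => ?_, fun t j hc => ?_,
    fun x p hp hx => ?_⟩
  · simp only [hP, Finset.sum_mul]
    rw [Finset.sum_comm]
    exact Finset.sum_congr rfl fun j _ => Finset.sum_congr rfl fun i _ => by ring
  · obtain ⟨i, -, hi⟩ := Finset.exists_ne_zero_of_sum_ne_zero hc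
    have h1 := hw i j (left_ne_zero_of_mul hi)
    have h2 := mem_Icc_of_bspline_ne_zero (right_ne_zero_of_mul hi)
    have h3 : knot n ((i : ℤ) - d - ρ) ≤ t := (knot_mono n (by omega)).trans h2.1
    have h4 : t ≤ knot n ((i : ℤ) + 1 + ρ) := h2.2.trans (knot_mono n (by omega))
    have h5 := knot_sub_knot_le n (by omega : (i : ℤ) - d - ρ ≤ (i : ℤ) + 1 + ρ)
    refine (abs_sub_le_of_le_of_le h1.1 h1.2 h3 h4).trans (h5.trans_eq ?_)
    push_cast
    ring
  · convert! hS _ (polynomial_mem_splineSpace d n hp) using 2 <;> ext t <;> simp [hx]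

section LocalReproducing

variable {d n : ℕ} {r : ℝ} {P : C(I, ℝ) →L[ℝ] C(I, ℝ)} {c : I → Fin (2 * n + 1) → ℝ}

/-- Truncating `x` to `[-η, η]` leaves its values at the nodes relevant to `t` unchanged, so the
global norm of `P` yields a local bound. -/
theorem IsLocalReproducing.abs_apply_le (h : IsLocalReproducing d n r P c) {M η : ℝ}
    (hM : ‖P‖ ≤ M) (hη : 0 ≤ η) (x : C(I, ℝ)) (t : I)
    (hx : ∀ τ : I, |(τ : ℝ) - t| ≤ r → |x τ| ≤ η) : |P x t| ≤ M * η := by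
  let x' : C(I, ℝ) := ⟨fun τ => max (-η) (min (x τ) η), by fun_prop⟩
  have hx' : ‖x'‖ ≤ η := (ContinuousMap.norm_le _ hη).2 fun τ =>
    abs_le.2 ⟨le_max_left _ _, max_le (by linarith) (min_le_right _ _)⟩
  have heq : P x t = P x' t := by
    rw [h.apply_eq, h.apply_eq]
    refine Finset.sum_congr rfl fun j _ => ?_
    by_cases hc : c t j = 0
    · simp [hc]
    · have := abs_le.1 (hx _ (h.dist_le t j hc))
      simp only [x', ContinuousMap.coe_mk]
      rw [min_eq_left this.2, max_eq_right this.1]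
  rw [heq]
  exact ((P x').norm_coe_le_norm t).trans (P.le_of_opNorm_le_of_le hM hx')

/-- `P` fixes the Taylor polynomial `p` at `t`, and `g t = p t` because `0 ^ β = 0`; hence the error
is `-P (g - p) t`, which only sees `g - p` within distance `r`. -/
theorem IsLocalReproducing.abs_sub_le (h : IsLocalReproducing d n r P c) {M β C : ℝ}
    (hr : 0 ≤ r) (hβ : 0 < β) (hC : 0 ≤ C) (hM : ‖P‖ ≤ M) {g : ℝ → ℝ}
    (hgc : ContinuousOn g (Icc 0 1)) (hg : HasTaylorBound d β C g) (t : I) :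
    |g t - ∑ j, c t j * g (node n j)| ≤ M * (C * r ^ β) := by
  obtain ⟨p, hp, hb⟩ := hg t t.2
  let q : C(I, ℝ) := ⟨fun t : I => p.eval (t : ℝ), by fun_prop⟩
  let x : C(I, ℝ) := ⟨fun t : I => g t, hgc.comp_continuous (by fun_prop) fun t => t.2⟩
  have hq : P q = q := h.reproduces q p hp fun _ => rfl
  have hxt : g t = p.eval (t : ℝ) := by
    have := hb t t.2
    rw [sub_self, abs_zero, Real.zero_rpow hβ.ne', mul_zero] at this
    exact sub_eq_zero.1 (abs_nonpos_iff.1 this)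
  have h1 : g t - ∑ j, c t j * g (node n j) = - P (x - q) t := by
    rw [map_sub, hq, ContinuousMap.sub_apply, h.apply_eq]
    simp [x, q, hxt]
  rw [h1, abs_neg]
  refine h.abs_apply_le hM (by positivity) _ _ fun τ hτ => (hb τ τ.2).trans ?_
  gcongr

end LocalReproducing

/-! ### The kernel and its integral operators -/

theorem isCompact_box (a b : ℝ) : IsCompact (box a b) :=
  isCompact_Icc.prod (isCompact_Icc.prod isCompact_Icc)

theorem uniqueDiffOn_box {a b : ℝ} (hab : a < b) : UniqueDiffOn ℝ (box a b) :=
  (uniqueDiffOn_Icc zero_lt_one).prod ((uniqueDiffOn_Icc zero_lt_one).prod (uniqueDiffOn_Icc hab))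

theorem IsCAlphaOn.exists_hasTaylorBound_box {a b α : ℝ} (hab : a < b) (hα : 0 ≤ α)
    {g : ℝ × ℝ × ℝ → ℝ} (hg : IsCAlphaOn α g (box a b)) (d : ℕ) :
    ∃ C, 0 ≤ C ∧ ∀ t ∈ Icc (0 : ℝ) 1, ∀ u ∈ Icc a b,
      HasTaylorBound d (min α ((d : ℝ) + 1)) C (fun s => g (s, t, u)) := by
  obtain ⟨C, hC, h⟩ := hg.exists_hasTaylorBound (uniqueDiffOn_box hab) (isCompact_box a b) hα
    (1, 0, 0) (by simp [Prod.norm_def]) d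
  refine ⟨C, hC, fun t ht u hu => h (fun s => (s, t, u)) (fun s hs => ⟨hs, ht, hu⟩) (fun x => ?_)
    fun x y => by simp [Prod.ext_iff]⟩
  exact (hasDerivAt_id x).prodMk ((hasDerivAt_const x t).prodMk (hasDerivAt_const x u))

theorem hasDerivWithinAt_partialU {k : ℝ × ℝ × ℝ → ℝ} {a b : ℝ} (hk : ContDiffOn ℝ 1 k (box a b))
    {s t u : ℝ} (hs : s ∈ Icc (0 : ℝ) 1) (ht : t ∈ Icc (0 : ℝ) 1) (hu : u ∈ Icc a b) :
    HasDerivWithinAt (fun u => k (s, t, u)) (partialU k a b (s, t, u)) (Icc a b) u := by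
  refine DifferentiableWithinAt.hasDerivWithinAt (f := fun u => k (s, t, u)) ?_
  exact (hk.differentiableOn (by simp) (s, t, u) ⟨hs, ht, hu⟩).comp
    (f := fun u : ℝ => (s, t, u)) (t := box a b) u
    (by fun_prop) fun v hv => ⟨hs, ht, hv⟩

theorem continuous_kernel_comp {k : ℝ × ℝ × ℝ → ℝ} (hk : ContinuousOn k kernelDomain) {s : ℝ}
    (hs : s ∈ Icc (0 : ℝ) 1) (x : C(I, ℝ)) : Continuous fun t : I => k (s, (t : ℝ), x t) :=
  hk.comp_continuous (by fun_prop) fun t => ⟨hs, t.2, mem_univ _⟩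

theorem integrable_of_continuous_unitInterval {f : I → ℝ} (hf : Continuous f) :
    Integrable f (volume : Measure I) :=
  hf.integrable_of_hasCompactSupport (HasCompactSupport.of_compactSpace _)

theorem abs_integral_le_of_forall_le {f : I → ℝ} {C : ℝ} (h : ∀ t, |f t| ≤ C) :
    |∫ t, f t| ≤ C := by
  simpa using norm_integral_le_of_norm_le_const (μ := (volume : Measure I)) (f := f) (C := C)
    (Eventually.of_forall h)

theorem exists_forall_mem_Icc {a b : ℝ} {φ : C(I, ℝ)} (hφ : ∀ s, φ s ∈ Ioo a b) :
    ∃ η > 0, ∀ x : C(I, ℝ), ‖x - φ‖ < η → ∀ s, x s ∈ Icc a b := by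
  have h := (ContinuousMap.isOpen_setOfPred_mapsTo (X := I) (Y := ℝ) isCompact_univ
    (isOpen_Ioo (a := a) (b := b))).mem_nhds (x := φ) fun s _ => hφ s
  obtain ⟨η, hη, hb⟩ := Metric.mem_nhds_iff.1 h
  exact ⟨η, hη, fun x hx s => Ioo_subset_Icc_self (hb (mem_ball_iff_norm.2 hx) (mem_univ s))⟩

/-- The linear integral operator with continuous kernel `κ`. -/
def fredholmOp (κ : C(I × I, ℝ)) : C(I, ℝ) →L[ℝ] C(I, ℝ) :=
  LinearMap.mkContinuous
    { toFun := fun z => ⟨fun s => ∫ t : I, κ (s, t) * z t, by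
        have h : Continuous (Function.uncurry fun s t : I => κ (s, t) * z t) := by fun_prop
        simpa using continuous_parametric_integral_of_continuous (μ := (volume : Measure I)) h
          isCompact_univ⟩
      map_add' := fun x y => by
        ext s
        simp only [ContinuousMap.add_apply, ContinuousMap.coe_mk, mul_add]
        exact integral_add (integrable_of_continuous_unitInterval (by fun_prop))
          (integrable_of_continuous_unitInterval (by fun_prop))
      map_smul' := fun r x => by
        ext s
        simp only [ContinuousMap.smul_apply, ContinuousMap.coe_mk, smul_eq_mul, RingHom.id_apply,
          mul_left_comm _ r]
        exact integral_const_mul _ _ }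
    ‖κ‖ fun z => (ContinuousMap.norm_le _ (by positivity)).2 fun s =>
      abs_integral_le_of_forall_le fun t => by
        rw [abs_mul]
        exact mul_le_mul (κ.norm_coe_le_norm _) (z.norm_coe_le_norm _) (abs_nonneg _)
          (norm_nonneg _)

theorem fredholmOp_apply (κ : C(I × I, ℝ)) (z : C(I, ℝ)) (s : I) :
    fredholmOp κ z s = ∫ t : I, κ (s, t) * z t := rfl

/-- The estimate covers all pairs `x, y` near `φ`, as a contraction argument requires. It is the
mean value inequality in `u` for `k - κ u`, with uniform continuity of `∂k/∂u` on the compact box.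
-/
theorem exists_strict_deriv_urysohn {k : ℝ × ℝ × ℝ → ℝ} (hk : ContinuousOn k kernelDomain)
    {a b : ℝ} (hk1 : ContDiffOn ℝ 1 k (box a b)) (hku : ContinuousOn (partialU k a b) (box a b))
    {φ : C(I, ℝ)} (hφ : ∀ s, φ s ∈ Ioo a b) :
    ∃ T : C(I, ℝ) →L[ℝ] C(I, ℝ), ∀ ε > 0, ∃ δ > 0, ∀ x y : C(I, ℝ), ‖x - φ‖ < δ → ‖y - φ‖ < δ →
      ‖urysohn k hk x - urysohn k hk y - T (x - y)‖ ≤ ε * ‖x - y‖ := by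
  have hφ' : ∀ s, φ s ∈ Icc a b := fun s => Ioo_subset_Icc_self (hφ s)
  let κ : C(I × I, ℝ) := ⟨fun p => partialU k a b ((p.1 : ℝ), (p.2 : ℝ), φ p.2),
    hku.comp_continuous (by fun_prop) fun p => ⟨p.1.2, p.2.2, hφ' _⟩⟩
  refine ⟨fredholmOp κ, fun ε hε => ?_⟩
  obtain ⟨η, hη, hηb⟩ := exists_forall_mem_Icc hφ
  obtain ⟨δ, hδ, hδb⟩ := Metric.uniformContinuousOn_iff_le.1
    ((isCompact_box a b).uniformContinuousOn_of_continuous hku) ε hε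
  refine ⟨min η δ, lt_min hη hδ, fun x y hx hy => ?_⟩
  refine (ContinuousMap.norm_le _ (by positivity)).2 fun s => ?_
  have heq : (urysohn k hk x - urysohn k hk y - fredholmOp κ (x - y)) s =
      ∫ t : I, (k (s, t, x t) - k (s, t, y t) - κ (s, t) * (x t - y t)) := by
    have h1 := integrable_of_continuous_unitInterval (continuous_kernel_comp hk s.2 x)
    have h2 := integrable_of_continuous_unitInterval (continuous_kernel_comp hk s.2 y)
    have h3 : Integrable (fun t : I => κ (s, t) * (x t - y t)) volume :=
      integrable_of_continuous_unitInterval (by fun_prop)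
    exact (congrArg₂ _ (integral_sub h1 h2).symm rfl).trans (integral_sub (h1.sub h2) h3).symm
  rw [heq]
  refine abs_integral_le_of_forall_le fun t => ?_
  have hsub := inter_subset_left (s := Icc a b) (t := Metric.closedBall (φ t) δ)
  have hmem : ∀ z : C(I, ℝ), ‖z - φ‖ < min η δ → z t ∈ Icc a b ∩ Metric.closedBall (φ t) δ := by
    refine fun z hz => ⟨hηb z (hz.trans_le (min_le_left _ _)) t, mem_closedBall_iff_norm.2 ?_⟩
    exact ((z - φ).norm_coe_le_norm t).trans (hz.le.trans (min_le_right _ _))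
  have hmvt := ((convex_Icc a b).inter (convex_closedBall (φ t) δ)
    ).norm_image_sub_le_of_norm_hasDerivWithin_le (C := ε)
    (f := fun u => k (s, t, u) - κ (s, t) * u)
    (f' := fun u => partialU k a b (s, t, u) - κ (s, t) * 1)
    (fun u hu => ((hasDerivWithinAt_partialU hk1 s.2 t.2 hu.1).mono hsub).sub
      ((hasDerivWithinAt_id u _).const_mul _)) (fun u hu => ?_) (hmem y hy) (hmem x hx)
  · calc |k (s, t, x t) - k (s, t, y t) - κ (s, t) * (x t - y t)|
        = ‖k (s, t, x t) - κ (s, t) * x t - (k (s, t, y t) - κ (s, t) * y t)‖ := by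
          rw [Real.norm_eq_abs]
          ring_nf
      _ ≤ ε * ‖x t - y t‖ := hmvt
      _ ≤ ε * ‖x - y‖ := by
          gcongr
          exact (x - y).norm_coe_le_norm t
  · rw [mul_one, ← dist_eq_norm]
    refine hδb _ ⟨s.2, t.2, hu.1⟩ _ ⟨s.2, t.2, hφ' t⟩ ?_
    simpa [Prod.dist_eq, hδ.le] using hu.2

theorem hasFDerivAt_of_strict_bound {E F : Type*} [NormedAddCommGroup E] [NormedSpace ℝ E]
    [NormedAddCommGroup F] [NormedSpace ℝ F] {K : E → F} {T : E →L[ℝ] F} {φ : E}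
    (h : ∀ ε > 0, ∃ δ > 0, ∀ x y : E, ‖x - φ‖ < δ → ‖y - φ‖ < δ →
      ‖K x - K y - T (x - y)‖ ≤ ε * ‖x - y‖) : HasFDerivAt K T φ := by
  refine .of_isLittleO (isLittleO_iff.2 fun ε hε => ?_)
  obtain ⟨δ, hδ, hb⟩ := h ε hε
  filter_upwards [Metric.ball_mem_nhds φ hδ] with x hx
  exact hb x φ (mem_ball_iff_norm.1 hx) (by simpa using hδ)

/-! ### The projection error on the range of the Urysohn operator -/

section Residual

variable {d n : ℕ} {r : ℝ} {P : C(I, ℝ) →L[ℝ] C(I, ℝ)} {c : I → Fin (2 * n + 1) → ℝ}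

/-- `P` is a finite sum over nodes in `s`, so it passes under the integral in `t`. Projection errors
of `K x` thus reduce to those of the sections `k(·, t, u)`. -/
theorem IsLocalReproducing.urysohn_sub_apply (h : IsLocalReproducing d n r P c)
    {k : ℝ × ℝ × ℝ → ℝ} (hk : ContinuousOn k kernelDomain) (x : C(I, ℝ)) (s : I) :
    (urysohn k hk x - P (urysohn k hk x)) s =
      ∫ t : I, (k (s, t, x t) - ∑ j, c s j * k (node n j, t, x t)) := by
  have hi : ∀ s : I, Integrable (fun t : I => k (s, t, x t)) volume := fun s =>
    integrable_of_continuous_unitInterval (continuous_kernel_comp hk s.2 x)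
  rw [integral_sub (hi s) (integrable_finsetSum _ fun j _ => (hi _).const_mul _),
    integral_finsetSum _ fun j _ => (hi _).const_mul _, ContinuousMap.sub_apply, h.apply_eq]
  simp only [integral_const_mul]
  rfl

theorem IsLocalReproducing.norm_urysohn_sub_le (h : IsLocalReproducing d n r P c)
    {k : ℝ × ℝ × ℝ → ℝ} (hk : ContinuousOn k kernelDomain) {a b M β C : ℝ} (hr : 0 ≤ r)
    (hβ : 0 < β) (hC : 0 ≤ C) (hM : ‖P‖ ≤ M)
    (hT : ∀ t ∈ Icc (0 : ℝ) 1, ∀ u ∈ Icc a b, HasTaylorBound d β C (fun s => k (s, t, u)))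
    {x : C(I, ℝ)} (hx : ∀ t, x t ∈ Icc a b) :
    ‖urysohn k hk x - P (urysohn k hk x)‖ ≤ M * (C * r ^ β) := by
  have hM0 : 0 ≤ M := (norm_nonneg P).trans hM
  refine (ContinuousMap.norm_le _ (by positivity)).2 fun s => ?_
  rw [h.urysohn_sub_apply hk x s]
  refine abs_integral_le_of_forall_le fun t => ?_
  exact h.abs_sub_le hr hβ hC hM (hk.comp (f := fun s : ℝ => (s, (t : ℝ), x t)) (by fun_prop)
    fun s hs => ⟨hs, t.2, mem_univ _⟩) (hT t t.2 (x t) (hx t)) s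

/-- The error `R t u` of the section `k(·, t, u)` has as its `u`-derivative the error of `∂k/∂u(·,
t, u)`, of order `r ^ β`; the mean value inequality in `u` supplies the factor `‖x - y‖`. -/
theorem IsLocalReproducing.norm_urysohn_sub_urysohn_sub_le (h : IsLocalReproducing d n r P c)
    {k : ℝ × ℝ × ℝ → ℝ} (hk : ContinuousOn k kernelDomain) {a b M β C : ℝ} (hr : 0 ≤ r)
    (hβ : 0 < β) (hC : 0 ≤ C) (hM : ‖P‖ ≤ M)
    (hk1 : ContDiffOn ℝ 1 k (box a b)) (hku : ContinuousOn (partialU k a b) (box a b))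
    (hT : ∀ t ∈ Icc (0 : ℝ) 1, ∀ u ∈ Icc a b,
      HasTaylorBound d β C (fun s => partialU k a b (s, t, u)))
    {x y : C(I, ℝ)} (hx : ∀ t, x t ∈ Icc a b) (hy : ∀ t, y t ∈ Icc a b) :
    ‖(urysohn k hk x - urysohn k hk y) - P (urysohn k hk x - urysohn k hk y)‖
      ≤ M * (C * r ^ β) * ‖x - y‖ := by
  have hM0 : 0 ≤ M := (norm_nonneg P).trans hM
  refine (ContinuousMap.norm_le _ (by positivity)).2 fun s => ?_
  let R : I → ℝ → ℝ := fun t u => k (s, t, u) - ∑ j, c s j * k (node n j, t, u)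
  have hR : ∀ z : C(I, ℝ), Integrable (fun t => R t (z t)) volume := fun z =>
    integrable_of_continuous_unitInterval <| (continuous_kernel_comp hk s.2 z).sub <|
      continuous_finsetSum _ fun j _ => (continuous_kernel_comp hk (node n j).2 z).const_mul _
  have heq : ((urysohn k hk x - urysohn k hk y) - P (urysohn k hk x - urysohn k hk y)) s =
      ∫ t, (R t (x t) - R t (y t)) := by
    rw [integral_sub (hR x) (hR y), ← h.urysohn_sub_apply hk, ← h.urysohn_sub_apply hk, map_sub,
      ← ContinuousMap.sub_apply]
    congr 1
    abel
  rw [heq]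
  refine abs_integral_le_of_forall_le fun t => ?_
  have hmvt := (convex_Icc a b).norm_image_sub_le_of_norm_hasDerivWithin_le
    (C := M * (C * r ^ β)) (f := R t)
    (f' := fun u => partialU k a b (s, t, u) - ∑ j, c s j * partialU k a b (node n j, t, u))
    (fun u hu => (hasDerivWithinAt_partialU hk1 s.2 t.2 hu).sub
      (HasDerivWithinAt.fun_sum fun j _ =>
        (hasDerivWithinAt_partialU hk1 (node n j).2 t.2 hu).const_mul _))
    (fun u hu => h.abs_sub_le hr hβ hC hM
      (hku.comp (f := fun s : ℝ => (s, (t : ℝ), u)) (by fun_prop) fun s hs => ⟨hs, t.2, hu⟩)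
      (hT t t.2 u hu) s) (hy t) (hx t)
  refine hmvt.trans ?_
  gcongr
  exact (x - y).norm_coe_le_norm t

theorem IsLocalReproducing.isCompactOperator (h : IsLocalReproducing d n r P c) :
    IsCompactOperator P := by
  let V : Submodule ℝ C(I, ℝ) := P.toLinearMap.range
  -- The coefficient functions `c · j` are not assumed continuous, so finite rank is established in
  -- `I → ℝ` and pulled back along the injective coercion.
  have hle : V.map (ContinuousMap.coeFnLinearMap ℝ : C(I, ℝ) →ₗ[ℝ] I → ℝ) ≤
      Submodule.span ℝ (range fun j t => c t j) := by
    rintro _ ⟨_, ⟨x, rfl⟩, rfl⟩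
    have : ⇑(P x) = ∑ j, x (node n j) • fun t => c t j := by
      ext t
      simp [h.apply_eq, mul_comm]
    change ⇑(P x) ∈ _
    rw [this]
    exact Submodule.sum_mem _ fun j _ => Submodule.smul_mem _ _ (Submodule.subset_span ⟨j, rfl⟩)
  have : FiniteDimensional ℝ (Submodule.span ℝ (range fun (j : Fin (2 * n + 1)) t => c t j)) :=
    FiniteDimensional.span_of_finite ℝ (finite_range _)
  have hV : FiniteDimensional ℝ V := by
    have h1 := Submodule.finiteDimensional_of_le hle
    let e := Submodule.equivMapOfInjective
      (ContinuousMap.coeFnLinearMap ℝ : C(I, ℝ) →ₗ[ℝ] I → ℝ) DFunLike.coe_injective V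
    exact Module.Finite.equiv e.symm
  have hid : IsCompactOperator (id : V → V) := isCompactOperator_id_iff_finiteDimensional.2 hV
  exact (hid.comp_clm (P.codRestrict V fun x => ⟨x, rfl⟩)).clm_comp V.subtypeL

end Residual

/-! ### Local solvability by contraction -/

/-- A map that is a contraction up to the invertible linear part `A` near `φ` has a unique zero
near `φ` if its residual at `φ` is small, and the distance of the zero to `φ` is controlled by the
residual. -/
theorem existsUnique_zero_of_approx {E : Type*} [NormedAddCommGroup E] [NormedSpace ℝ E]
    [CompleteSpace E] (A : E ≃L[ℝ] E) {G : E → E} {φ : E} {δ B ε : ℝ} (hδ : 0 < δ) (hB : 0 < B)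
    (hA : ‖(A.symm : E →L[ℝ] E)‖ ≤ B) (hε : B * ε ≤ 1 / 2)
    (hG : ∀ x ∈ Metric.ball φ δ, ∀ y ∈ Metric.ball φ δ, ‖G x - G y - A (x - y)‖ ≤ ε * ‖x - y‖)
    (hres : B * ‖G φ‖ ≤ δ / 4) :
    (∃! y, y ∈ Metric.ball φ δ ∧ G y = 0) ∧
      ∀ y ∈ Metric.ball φ δ, G y = 0 → ‖y - φ‖ ≤ 2 * B * ‖G φ‖ := by
  -- Simplified Newton map, with the fixed derivative `A`.
  let N : E → E := fun y => y - A.symm (G y)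
  have hsymm : ∀ z, ‖A.symm z‖ ≤ B * ‖z‖ := fun z =>
    (A.symm : E →L[ℝ] E).le_of_opNorm_le hA z
  have hfix : ∀ y, N y = y ↔ G y = 0 := fun y => by simp [N]
  have hN : ∀ x ∈ Metric.ball φ δ, ∀ y ∈ Metric.ball φ δ, ‖N x - N y‖ ≤ 1 / 2 * ‖x - y‖ := by
    intro x hx y hy
    have h1 : N x - N y = - A.symm (G x - G y - A (x - y)) := by
      simp only [N, map_sub, ContinuousLinearEquiv.symm_apply_apply]
      abel
    rw [h1, norm_neg]
    calc _ ≤ B * (ε * ‖x - y‖) := (hsymm _).trans (by gcongr; exact hG x hx y hy)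
      _ = B * ε * ‖x - y‖ := by ring
      _ ≤ _ := by gcongr
  have hφ : φ ∈ Metric.ball φ δ := Metric.mem_ball_self hδ
  have hNφ : ‖N φ - φ‖ ≤ B * ‖G φ‖ := by
    have : N φ - φ = - A.symm (G φ) := by simp [N]
    rw [this, norm_neg]
    exact hsymm _
  have hest : ∀ y ∈ Metric.ball φ δ, ‖N y - φ‖ ≤ 1 / 2 * ‖y - φ‖ + B * ‖G φ‖ := by
    intro y hy
    calc ‖N y - φ‖ = ‖(N y - N φ) + (N φ - φ)‖ := by congr 1; abel
      _ ≤ _ := (norm_add_le _ _).trans (add_le_add (hN y hy φ hφ) hNφ)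
  have hsub : Metric.closedBall φ (δ / 2) ⊆ Metric.ball φ δ :=
    Metric.closedBall_subset_ball (by linarith)
  -- The radius closes up: `1/2 * (δ/2) + δ/4 = δ/2`.
  have hmaps : MapsTo N (Metric.closedBall φ (δ / 2)) (Metric.closedBall φ (δ / 2)) := by
    intro y hy
    have := hest y (hsub hy)
    rw [mem_closedBall_iff_norm] at hy ⊢
    linarith
  have hcon : ContractingWith (1 / 2) (hmaps.restrict N _ _) := by
    refine ⟨by norm_num, LipschitzWith.of_dist_le_mul fun x y => ?_⟩
    rw [Subtype.dist_eq, Subtype.dist_eq, dist_eq_norm, dist_eq_norm]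
    simpa using hN x (hsub x.2) y (hsub y.2)
  obtain ⟨y, hy, hyN, -⟩ := hcon.exists_fixedPoint' Metric.isClosed_closedBall.isComplete hmaps
    (Metric.mem_closedBall_self (by linarith)) (edist_ne_top _ _)
  refine ⟨⟨y, ⟨hsub hy, (hfix y).1 hyN⟩, fun z ⟨hz, hzG⟩ => ?_⟩, fun z hz hzG => ?_⟩
  · have h1 := hN z hz y (hsub hy)
    rw [(hfix z).2 hzG, show N y = y from hyN] at h1
    exact sub_eq_zero.1 (norm_le_zero_iff.1 (by linarith))
  · have h1 := hest z hz
    rw [(hfix z).2 hzG] at h1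
    linarith

end SplineQIP

end

/-! ### Convergence of the modified projection method -/

open SplineQIP in
theorem theorem2
    -- the degree of the splines, the order of smoothness, and the locality of the functionals
    (d : ℕ) (hd : 1 ≤ d) (α : ℝ) (hα : 1 ≤ α) (ρ : ℕ)
    -- the equation `x - K(x) = f` and its unique solution `φ` in `C[0,1]`
    (k : ℝ × ℝ × ℝ → ℝ) (hk : ContinuousOn k SplineQIP.kernelDomain)
    (f φ : C(unitInterval, ℝ))
    (hφ : ∀ x : C(unitInterval, ℝ), x - SplineQIP.urysohn k hk x = f ↔ x = φ)
    -- the smoothness assumptions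
    (a b : ℝ) (hab : ∀ s, φ s ∈ Set.Ioo a b)
    (hkα : SplineQIP.IsCAlphaOn α k (SplineQIP.box a b))
    (hkuα : SplineQIP.IsCAlphaOn (2 * α) (SplineQIP.partialU k a b) (SplineQIP.box a b))
    (hfα : SplineQIP.IsCAlphaOn α (SplineQIP.onReal f) (Set.Icc 0 1))
    -- `1` is not an eigenvalue of the Fréchet derivative of `K` at `φ`
    (heig : ¬ Module.End.HasEigenvalue
      (fderiv ℝ (SplineQIP.urysohn k hk) φ : C(unitInterval, ℝ) →ₗ[ℝ] C(unitInterval, ℝ)) 1)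
    -- the uniformly bounded spline quasi-interpolating projectors
    (π : ℕ → (C(unitInterval, ℝ) →L[ℝ] C(unitInterval, ℝ)))
    (hπ : ∀ᶠ n in Filter.atTop, SplineQIP.IsQIP d ρ n (π n))
    (hπb : ∃ M : ℝ, ∀ᶠ n in Filter.atTop, ‖π n‖ ≤ M) :
    ∃ δ : ℝ, 0 < δ ∧
      (∀ᶠ n in Filter.atTop, ∃! y : C(unitInterval, ℝ), y ∈ Metric.ball φ δ ∧
        y - SplineQIP.modifiedOp (SplineQIP.urysohn k hk) (π n) y = f) ∧
      ∀ φH : ℕ → C(unitInterval, ℝ),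
        (∀ᶠ n in Filter.atTop, φH n ∈ Metric.ball φ δ ∧
          φH n - SplineQIP.modifiedOp (SplineQIP.urysohn k hk) (π n) (φH n) = f) →
        (fun n => ‖φH n - φ‖) =O[Filter.atTop]
          (fun n => (1 / (n : ℝ)) ^ (2 * min α ((d : ℝ) + 1))) := by
  set K := urysohn k hk
  set β := min α ((d : ℝ) + 1)
  have hβ : 0 < β := lt_min (by linarith) (by positivity)
  have hab' : a < b := (hab 0).1.trans (hab 0).2
  have hφ' : ∀ s, φ s ∈ Icc a b := fun s => Ioo_subset_Icc_self (hab s)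
  have hφK : φ - K φ = f := (hφ φ).2 rfl
  have hk1 : ContDiffOn ℝ 1 k (box a b) :=
    hkα.1.of_le (by exact_mod_cast Nat.le_floor (by exact_mod_cast hα))
  have hku : ContinuousOn (partialU k a b) (box a b) := hkuα.1.continuousOn
  -- local polynomial approximation of the data
  obtain ⟨Ck, hCk, hTk⟩ := hkα.exists_hasTaylorBound_box hab' (by linarith) d
  obtain ⟨Cu, hCu, hTu⟩ := hkuα.exists_hasTaylorBound_box hab' (by linarith) d
  -- Since `α ≤ 2 * α`, this factor too can be stated with the common order `β`.
  replace hTu : ∀ t ∈ Icc (0 : ℝ) 1, ∀ u ∈ Icc a b,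
      HasTaylorBound d β Cu (fun s => partialU k a b (s, t, u)) := fun t ht u hu =>
    (hTu t ht u hu).mono hβ (min_le_min_right _ (by linarith)) hCu le_rfl
  obtain ⟨Cf, hCf, hTf⟩ := hfα.exists_hasTaylorBound (uniqueDiffOn_Icc zero_lt_one)
    isCompact_Icc (by linarith) (1 : ℝ) (by simp) d
  replace hTf := hTf id (mapsTo_id _) hasDerivAt_id (by simp)
  -- the projection errors
  obtain ⟨M, hMev⟩ : ∃ M : ℝ, 0 ≤ M ∧ ∀ᶠ n in atTop, ‖π n‖ ≤ M := by
    obtain ⟨M, hM⟩ := hπb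
    exact ⟨|M|, abs_nonneg _, hM.mono fun n hn => hn.trans (le_abs_self M)⟩
  obtain ⟨hM0, hM⟩ := hMev
  let L : ℝ := (d + 1 + 2 * ρ : ℕ)
  let q : ℕ → ℝ := fun n => (1 / (n : ℝ)) ^ β
  have hL : 0 ≤ L := Nat.cast_nonneg _
  have hq0 : ∀ n, 0 ≤ q n := fun n => by positivity
  have hq : Tendsto q atTop (𝓝 0) := by
    have := tendsto_one_div_atTop_nhds_zero_nat (𝕜 := ℝ).rpow_const (p := β) (Or.inr hβ.le)
    rwa [Real.zero_rpow hβ.ne'] at this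
  have hLq : ∀ n : ℕ, (L * (1 / (n : ℝ))) ^ β = L ^ β * q n := fun n =>
    Real.mul_rpow hL (by positivity)
  let c₁ : ℝ := M * (Cu * L ^ β)
  let c₂ : ℝ := M * ((Cf + Ck) * L ^ β)
  have hc₁ : 0 ≤ c₁ := by positivity
  have hc₂ : 0 ≤ c₂ := by positivity
  have hdiff : ∀ᶠ n in atTop, ∀ x y : C(I, ℝ), (∀ t, x t ∈ Icc a b) → (∀ t, y t ∈ Icc a b) →
      ‖(K x - K y) - π n (K x - K y)‖ ≤ c₁ * q n * ‖x - y‖ := by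
    filter_upwards [hπ, hM] with n hn hMn x y hx hy
    obtain ⟨c, hc⟩ := hn.exists_isLocalReproducing
    refine (hc.norm_urysohn_sub_urysohn_sub_le hk (by positivity) hβ hCu hMn hk1 hku hTu hx
      hy).trans_eq ?_
    rw [hLq]
    ring
  have hproj : ∀ᶠ n in atTop, ‖π n φ - φ‖ ≤ c₂ * q n := by
    filter_upwards [hπ, hM] with n hn hMn
    obtain ⟨c, hc⟩ := hn.exists_isLocalReproducing
    have h1 := hc.norm_urysohn_sub_le hk (by positivity) hβ hCk hMn hTk hφ'
    have h2 : ‖f - π n f‖ ≤ M * (Cf * (L * (1 / (n : ℝ))) ^ β) := by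
      refine (ContinuousMap.norm_le _ (by positivity)).2 fun s => ?_
      have h3 := hc.abs_sub_le (by positivity) hβ hCf hMn
        ((f.continuous.Icc_extend' (h := zero_le_one)).continuousOn) hTf s
      have h4 : ∀ s : I, (onReal f ∘ id) (s : ℝ) = f s := fun s => IccExtend_val _ _ s
      change |IccExtend zero_le_one f s - ∑ j, c s j * IccExtend zero_le_one f (node n j)| ≤ _ at h3
      simp only [IccExtend_val] at h3
      rwa [ContinuousMap.sub_apply, hc.apply_eq]
    have h3 : π n φ - φ = -((f - π n f) + (K φ - π n (K φ))) := by
      rw [← hφK, map_sub]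
      abel
    rw [h3, norm_neg]
    refine (norm_add_le _ _).trans ((add_le_add h2 h1).trans_eq ?_)
    change _ + M * (Ck * (L * (1 / (n : ℝ))) ^ β) = _
    rw [hLq]
    ring
  -- invertibility of `1 - K'(φ)`
  obtain ⟨T, hT⟩ := exists_strict_deriv_urysohn hk hk1 hku hab
  have hTd : HasFDerivAt K T φ := hasFDerivAt_of_strict_bound hT
  obtain ⟨η, hη, hηb⟩ := exists_forall_mem_Icc hab
  -- `T - π n ∘ T` is the derivative at `φ` of `K - π n ∘ K`, so its norm is at most the local
  -- Lipschitz constant `c₁ * q n`, which tends to `0`.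
  have hTcpt : IsCompactOperator T := by
    refine isCompactOperator_of_tendsto (l := atTop) (F := fun n => (π n).comp T) ?_ ?_
    · refine tendsto_iff_norm_sub_tendsto_zero.2 (squeeze_zero' (.of_forall fun _ => norm_nonneg _)
        (g := fun n => c₁ * q n) ?_ (by simpa using hq.const_mul c₁))
      filter_upwards [hdiff] with n hn
      rw [norm_sub_rev]
      refine (hTd.sub ((π n).hasFDerivAt.comp φ hTd)).le_of_lip' (mul_nonneg hc₁ (hq0 n)) ?_
      filter_upwards [Metric.ball_mem_nhds φ hη] with x hx
      refine le_trans (le_of_eq ?_) (hn x φ (hηb x (mem_ball_iff_norm.1 hx)) hφ')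
      congr 1
      simp only [Pi.sub_apply, Function.comp_apply, map_sub]
      abel
    · filter_upwards [hπ] with n hn
      obtain ⟨c, hc⟩ := hn.exists_isLocalReproducing
      exact hc.isCompactOperator.comp_clm T
  obtain ⟨A, hA⟩ : ∃ A : C(I, ℝ) ≃L[ℝ] C(I, ℝ), ∀ x, A x = x - T x := by
    rw [hTd.fderiv] at heig
    have h1 := (hTcpt.hasEigenvalue_or_mem_resolventSet one_ne_zero).resolve_left heig
    rw [spectrum.mem_resolventSet_iff, map_one] at h1
    obtain ⟨u, hu⟩ := h1
    refine ⟨ContinuousLinearEquiv.unitsEquiv ℝ _ u, fun x => ?_⟩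
    rw [ContinuousLinearEquiv.unitsEquiv_apply, hu]
    rfl
  -- the contraction argument
  let B : ℝ := ‖(A.symm : C(I, ℝ) →L[ℝ] C(I, ℝ))‖ + 1
  have hB : 0 < B := by positivity
  -- The contraction allows a total defect `1 / (2 * B)`: half for the nonlinearity of `K`, half for
  -- the projection terms.
  obtain ⟨δ₀, hδ₀, hδ₀b⟩ := hT (1 / (4 * B)) (by positivity)
  -- The last entry keeps `π n x` within `η` of `φ`: `M * δ ≤ η / 2` for the projected displacement,
  -- and `c₂ * q n < η / 2` for `π n φ - φ`.
  let δ : ℝ := min δ₀ (min η (η / (2 * (M + 1))))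
  have hδ : 0 < δ := by positivity
  have hδ₁ : δ ≤ δ₀ := min_le_left _ _
  have hδ₂ : δ ≤ η := (min_le_right _ _).trans (min_le_left _ _)
  have hδ₃ : M * δ ≤ η / 2 := by
    have h1 : δ ≤ η / (2 * (M + 1)) := (min_le_right _ _).trans (min_le_right _ _)
    rw [le_div_iff₀ (by positivity)] at h1
    linarith
  let G : ℕ → C(I, ℝ) → C(I, ℝ) := fun n y => y - modifiedOp K (π n) y - f
  have hGzero : ∀ n y, y - modifiedOp K (π n) y = f ↔ G n y = 0 := fun n y => sub_eq_zero.symm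
  have hball : ∀ᶠ n in atTop, ∀ x ∈ Metric.ball φ δ, ∀ t, π n x t ∈ Icc a b := by
    have h1 : ∀ᶠ n in atTop, c₂ * q n < η / 2 :=
      (show Tendsto (fun n => c₂ * q n) atTop (𝓝 0) by simpa using hq.const_mul c₂
        ).eventually_lt_const (by positivity)
    filter_upwards [hproj, hM, h1] with n hn hMn hn1 x hx
    refine hηb _ ?_
    have h2 : ‖π n (x - φ)‖ ≤ M * δ :=
      (π n).le_of_opNorm_le_of_le hMn (mem_ball_iff_norm.1 hx).le
    calc ‖π n x - φ‖ = ‖π n (x - φ) + (π n φ - φ)‖ := by rw [map_sub]; congr 1; abel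
      _ ≤ _ := norm_add_le _ _
      _ < η := by linarith
  have hres : ∀ᶠ n in atTop, ‖G n φ‖ ≤ c₁ * c₂ * q n ^ 2 := by
    filter_upwards [hdiff, hproj, hball] with n hn hn2 hn3
    have h1 : G n φ = (K φ - K (π n φ)) - π n (K φ - K (π n φ)) := by
      simp only [G, modifiedOp, map_sub]
      rw [← hφK]
      abel
    rw [h1]
    calc _ ≤ c₁ * q n * ‖φ - π n φ‖ := hn _ _ hφ' (hn3 φ (Metric.mem_ball_self hδ))
      _ ≤ c₁ * q n * (c₂ * q n) := by
        rw [norm_sub_rev]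
        exact mul_le_mul_of_nonneg_left hn2 (mul_nonneg hc₁ (hq0 n))
      _ = _ := by ring
  have hmain : ∀ᶠ n in atTop, (∃! y, y ∈ Metric.ball φ δ ∧ G n y = 0) ∧
      ∀ y ∈ Metric.ball φ δ, G n y = 0 → ‖y - φ‖ ≤ 2 * B * ‖G n φ‖ := by
    have h1 : ∀ᶠ n in atTop, c₁ * (1 + M) * q n < 1 / (4 * B) :=
      (show Tendsto (fun n => c₁ * (1 + M) * q n) atTop (𝓝 0) by
        simpa using hq.const_mul (c₁ * (1 + M))).eventually_lt_const (by positivity)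
    have h2 : ∀ᶠ n in atTop, B * (c₁ * c₂ * q n ^ 2) < δ / 4 :=
      (show Tendsto (fun n => B * (c₁ * c₂ * q n ^ 2)) atTop (𝓝 0) by
        simpa using ((hq.pow 2).const_mul (c₁ * c₂)).const_mul B).eventually_lt_const
          (by positivity)
    filter_upwards [hdiff, hball, hres, hM, h1, h2] with n hn hbn hrn hMn hn1 hn2
    refine existsUnique_zero_of_approx A hδ hB (by simp [B]) (ε := 1 / (2 * B))
      (by field_simp; norm_num) (fun x hx y hy => ?_)
      ((mul_le_mul_of_nonneg_left hrn hB.le).trans hn2.le)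
    have hx' := mem_ball_iff_norm.1 hx
    have hy' := mem_ball_iff_norm.1 hy
    have e1 := hδ₀b x y (hx'.trans_le hδ₁) (hy'.trans_le hδ₁)
    have e2 := hn x y (hηb x (hx'.trans_le hδ₂)) (hηb y (hy'.trans_le hδ₂))
    have e3 := hn (π n x) (π n y) (hbn x hx) (hbn y hy)
    have e4 : ‖π n x - π n y‖ ≤ M * ‖x - y‖ := by
      rw [← map_sub]
      exact (π n).le_of_opNorm_le hMn _
    -- The defect splits into the linearisation error of `K` and the `(1 - π n)`-errors of two
    -- differences of `K`, at `x, y` and at their projections.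
    have e5 : G n x - G n y - A (x - y) = -(K x - K y - T (x - y))
        + ((K x - K y) - π n (K x - K y))
        - ((K (π n x) - K (π n y)) - π n (K (π n x) - K (π n y))) := by
      rw [hA]
      simp only [G, modifiedOp, map_sub]
      abel
    rw [e5]
    refine (norm_sub_le _ _).trans ((add_le_add_left (norm_add_le _ _) _).trans ?_)
    rw [norm_neg]
    have e6 : c₁ * q n * ‖π n x - π n y‖ ≤ c₁ * q n * (M * ‖x - y‖) :=
      mul_le_mul_of_nonneg_left e4 (mul_nonneg hc₁ (hq0 n))
    have e7 : c₁ * (1 + M) * q n * ‖x - y‖ ≤ 1 / (4 * B) * ‖x - y‖ := by gcongr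
    have e8 : 1 / (2 * B) * ‖x - y‖ = 1 / (4 * B) * ‖x - y‖ + 1 / (4 * B) * ‖x - y‖ := by
      field_simp
      ring
    linarith
  refine ⟨δ, hδ, ?_, fun φH hφH => ?_⟩
  · filter_upwards [hmain] with n hn
    simpa only [hGzero] using hn.1
  · refine IsBigO.of_bound (2 * B * (c₁ * c₂)) ?_
    filter_upwards [hmain, hres, hφH] with n hn hrn ⟨hb, heq⟩
    have h1 := hn.2 _ hb ((hGzero n _).1 heq)
    have h2 : (1 / (n : ℝ)) ^ (2 * β) = q n ^ 2 := by
      rw [mul_comm, Real.rpow_mul (by positivity), Real.rpow_two]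
    rw [h2, norm_norm, Real.norm_of_nonneg (sq_nonneg _)]
    refine h1.trans ?_
    rw [mul_assoc (2 * B)]
    gcongr
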